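/- Let $d,n$ be positive integers, let $\mathbb T=\mathbb R\cup\{\infty\}$, and let $V=(v_{ik})\in\mathbb T^{d\times n}$ be a matrix each of whose columns $v^{(1)},\dots,v^{(n)}$ has at least one finite entry. Identify $v^{(k)}$ with the min-tropical linear form $\min_i (v_{ik}+x_i)$ and $-v^{(k)}$ with the max-tropical linear form $\max_i (x_i-v_{ik})$. The support $\operatorname{supp}(F)$ of a tropical polynomial $F$ is the set of its exponent vectors whose coefficient is finite. For a finite point configuration $P$ with heights $\lambda:P\to\mathbb R$, the regular subdivision $\Sigma(P,\lambda)$ is the set of images, under omitting the last coordinate, of the nonempty bounded faces of $\operatorname{conv}\{(p,\lambda(p)) : p\in P\}+\mathbb R_{\ge 0}(\mathbf 0,1)$. For a min-tropical polynomial $F$ let $\Sigma(F)$ be the regular subdivision of $\operatorname{supp}(F)$ whose heights are the coefficients of $F$. Put $\Sigma(V):=\Sigma(v^{(1)}\odot\cdots\odot v^{(n)})$, where $\odot$ is the product of formal tropical polynomials. Let $u_1,\dots,u_n$ be an affine basis of $\mathbb R^{n-1}$. For subsets $A_k\subseteq\operatorname{supp}(v^{(k)})$ write $\operatorname{Cayley}(A_1,\dots,A_n)=\bigcup_k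 A_k\times\{u_k\}$ and $M(A_1,\dots,A_n)=\operatorname{conv}(A_1+\cdots+A_n)$. Let $\Sigma_{\mathcal C}$ be the regular subdivision of $\operatorname{Cayley}(\operatorname{supp}(v^{(1)}),\dots,\operatorname{supp}(v^{(n)}))$ in which $(e_i,u_k)$ has height $v_{ik}$. Let $M(\Sigma(v^{(1)}),\dots,\Sigma(v^{(n)}))$ be the mixed subdivision induced by $\Sigma_{\mathcal C}$, that is, the set of all $M(A_1,\dots,A_n)$ with all $A_k\subseteq\operatorname{supp}(v^{(k)})$ nonempty and $\operatorname{conv}\operatorname{Cayley}(A_1,\dots,A_n)\in\Sigma_{\mathcal C}$. Then: 1. $\Sigma(V)=M(\Sigma(v^{(1)}),\dots,\Sigma(v^{(n)}))$. 2. The cells of this mixed subdivision are formed from cells of the $\Sigma(v^{(k)})$: if all $A_k\subseteq\operatorname{supp}(v^{(k)})$ are nonempty and $\operatorname{conv}\operatorname{Cayley}(A_1,\dots,A_n)\in\Sigma_{\mathcal C}$, then $\operatorname{conv}(A_k)\in\Sigma(v^{(k)})$ for every $k$. 3. $\Sigma(V)$ is dual to the max-tropical hypersurface $\mathcal T_{\max}(-V)\subset\mathbb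 R^d$ of the max-tropical polynomial $H=(-v^{(1)})\odot\cdots\odot(-v^{(n)})$, i.e. to the set of points at which the maximum $H(x)$ is attained by at least two terms of $H$ (with distinct exponent vectors). Precisely, let $N$ be the normal complex of $H$, whose cells are the images, under omitting the last coordinate, of the nonempty proper faces of $\{(x,s)\in\mathbb R^d\times\mathbb R : s\ge H(x)\}$. Then $\mathcal T_{\max}(-V)$ is the union of the cells of $N$ of dimension less than $d$, and sending a cell $\sigma\in N$ to the convex hull of the exponent vectors in $\operatorname{supp}(H)$ that attain the maximum at all points of $\sigma$ is an inclusion-reversing bijection (with inclusion-reversing inverse) from $N$ onto $\Sigma(V)$ such that the dimensions of corresponding cells add up to $d$. -/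

import Mathlib

open Set Bornology
open scoped Pointwise

noncomputable section

namespace TropCayley

/-! ### Tropical polynomials -/

/-- The min-tropical semiring `ℝ ∪ {∞}`: addition is `min`, multiplication is `+`. -/
abbrev MinTropical : Type := Tropical (WithTop ℝ)

/-- The max-tropical semiring `ℝ ∪ {-∞}`: addition is `max`, multiplication is `+`.
Since the order of `ℝᵒᵈ` is reversed, its minimum is `max`, and the added top element is `-∞`. -/
abbrev MaxTropical : Type := Tropical (WithTop ℝᵒᵈ)

/-- Formal min-tropical Laurent polynomials in `d` variables, as a semiring. -/
abbrev MinPoly (d : ℕ) : Type := AddMonoidAlgebra MinTropical (Fin d → ℤ)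

/-- Formal max-tropical Laurent polynomials in `d` variables, as a semiring. -/
abbrev MaxPoly (d : ℕ) : Type := AddMonoidAlgebra MaxTropical (Fin d → ℤ)

variable {d n : ℕ}

/-- The support: the exponents whose coefficient is not `∞` (the zero of the tropical semiring). -/
def minSupp (F : MinPoly d) : Finset (Fin d → ℤ) := F.coeff.support

/-- The support: the exponents whose coefficient is not `-∞` (the zero of the max-tropical
semiring). -/
def maxSupp (H : MaxPoly d) : Finset (Fin d → ℤ) := H.coeff.support

/-- The coefficient of `F` at an exponent `m` of its support, as a real number. -/
def minCoeff (F : MinPoly d) (m : Fin d → ℤ) : ℝ :=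
  (Tropical.untrop (F.coeff m)).untopD 0

/-- The coefficient of `H` at an exponent `m` of its support, as a real number. -/
def maxCoeff (H : MaxPoly d) (m : Fin d → ℤ) : ℝ :=
  OrderDual.ofDual ((Tropical.untrop (H.coeff m)).untopD (OrderDual.toDual 0))

/-- An integer vector as a point of `ℝ^d`. -/
def latticePt (m : Fin d → ℤ) : Fin d → ℝ := fun i => (m i : ℝ)

/-- The min-tropical linear form `min (x₁ + v₁, …, x_d + v_d)`. -/
def minLinearForm (v : Fin d → WithTop ℝ) : MinPoly d :=
  ∑ i, AddMonoidAlgebra.single (Pi.single i 1) (Tropical.trop (v i))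

/-- Negation `ℝ ∪ {∞} → ℝ ∪ {-∞}`. -/
def negTrop (a : WithTop ℝ) : WithTop ℝᵒᵈ := a.map fun r => OrderDual.toDual (-r)

/-- The max-tropical linear form `-v`, that is, `max (x₁ - v₁, …, x_d - v_d)`. -/
def negMaxLinearForm (v : Fin d → WithTop ℝ) : MaxPoly d :=
  ∑ i, AddMonoidAlgebra.single (Pi.single i 1) (Tropical.trop (negTrop (v i)))

/-- The product of the min-tropical linear forms given by the columns of `V`. -/
def columnProduct (V : Matrix (Fin d) (Fin n) (WithTop ℝ)) : MinPoly d :=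
  ∏ k, minLinearForm fun i => V i k

/-- The product of the max-tropical linear forms given by the columns of `-V`. -/
def negColumnProduct (V : Matrix (Fin d) (Fin n) (WithTop ℝ)) : MaxPoly d :=
  ∏ k, negMaxLinearForm fun i => V i k

/-! ### Regular subdivisions -/

section Regular

variable {ι E : Type*} [NormedAddCommGroup E] [NormedSpace ℝ E]

/-- The polyhedron `conv {(p i, h i)} + ℝ≥0 (0, 1)` of the points `p i` lifted to heights `h i`. -/
def liftedPolyhedron (p : ι → E) (h : ι → ℝ) : Set (E × ℝ) :=
  convexHull ℝ (range fun i => (p i, h i)) + {q | q.1 = 0 ∧ 0 ≤ q.2}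

/-- The regular subdivision of the point configuration `p` with heights `h`: its cells are the
projections of the nonempty bounded faces of `liftedPolyhedron p h`. (All nonempty faces of a
polyhedron are exposed.) -/
def regularSubdivision (p : ι → E) (h : ι → ℝ) : Set (Set E) :=
  {C | ∃ F, IsExposed ℝ (liftedPolyhedron p h) F ∧ F.Nonempty ∧ IsBounded F ∧
    C = Prod.fst '' F}

end Regular

/-- The regular subdivision of the support of a min-tropical polynomial, where the heights are the
coefficients. -/
def polySubdivision (F : MinPoly d) : Set (Set (Fin d → ℝ)) :=
  regularSubdivision (fun m : {m // m ∈ minSupp F} => latticePt m.1) (fun m => minCoeff F m.1)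

/-! ### Cayley embedding and mixed subdivisions -/

section Cayley

variable {W : Type*} [NormedAddCommGroup W] [NormedSpace ℝ W]

/-- The regular subdivision of the Cayley embedding `{(m, u k) | m ∈ supp (F k)}` of the supports
of `F 1, …, F n`, where `(m, u k)` is lifted to the coefficient of `F k` at `m`. -/
def cayleySubdivision (u : Fin n → W) (F : Fin n → MinPoly d) :
    Set (Set ((Fin d → ℝ) × W)) :=
  regularSubdivision
    (fun x : (Σ k, {m // m ∈ minSupp (F k)}) => (latticePt x.2.1, u x.1))
    (fun x => minCoeff (F x.1) x.2.1)

/-- The Cayley cell `conv (⋃ k, A k × {u k})`. -/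
def cayleyCell (u : Fin n → W) (A : Fin n → Finset (Fin d → ℤ)) : Set ((Fin d → ℝ) × W) :=
  convexHull ℝ {q | ∃ k, ∃ m ∈ A k, q = (latticePt m, u k)}

/-- The Minkowski cell `M (A 1, …, A n) = conv {a 1 + ⋯ + a n | a k ∈ A k}`. -/
def minkowskiCell (A : Fin n → Finset (Fin d → ℤ)) : Set (Fin d → ℝ) :=
  convexHull ℝ {q | ∃ a : Fin n → Fin d → ℤ, (∀ k, a k ∈ A k) ∧ q = ∑ k, latticePt (a k)}

/-- `A` labels a cell of the mixed subdivision: nonempty subsets of the supports whose Cayley cell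
belongs to the regular subdivision of the Cayley embedding. -/
def IsMixedLabel (u : Fin n → W) (F : Fin n → MinPoly d)
    (A : Fin n → Finset (Fin d → ℤ)) : Prop :=
  (∀ k, A k ⊆ minSupp (F k)) ∧ (∀ k, (A k).Nonempty) ∧ cayleyCell u A ∈ cayleySubdivision u F

/-- The mixed subdivision of `supp (F 1) + ⋯ + supp (F n)` induced by the regular subdivision of
the Cayley embedding: the set of its (nonempty) cells `M (A 1, …, A n)`. -/
def mixedSubdivision (u : Fin n → W) (F : Fin n → MinPoly d) : Set (Set (Fin d → ℝ)) :=
  {C | ∃ A, IsMixedLabel u F A ∧ C = minkowskiCell A}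

end Cayley

/-! ### Max-tropical hypersurfaces and duality -/

/-- The value at `x` of the term of `H` with exponent `m`. -/
def maxTerm (H : MaxPoly d) (m : Fin d → ℤ) (x : Fin d → ℝ) : ℝ :=
  maxCoeff H m + ∑ i, (m i : ℝ) * x i

/-- The exponents at which the maximum `H x` is attained. -/
def maximizers (H : MaxPoly d) (x : Fin d → ℝ) : Set (Fin d → ℤ) :=
  {m | m ∈ maxSupp H ∧ ∀ m' ∈ maxSupp H, maxTerm H m' x ≤ maxTerm H m x}

/-- The max-tropical hypersurface: the points where the maximum is attained at least twice. -/
def maxHypersurface (H : MaxPoly d) : Set (Fin d → ℝ) :=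
  {x | (maximizers H x).Nontrivial}

/-- The dome `{(x, s) | s ≥ H x}` of a max-tropical polynomial. -/
def maxDome (H : MaxPoly d) : Set ((Fin d → ℝ) × ℝ) :=
  {q | ∀ m ∈ maxSupp H, maxTerm H m q.1 ≤ q.2}

/-- The normal complex of `H`, a polyhedral subdivision of `ℝ^d`: its cells are the projections of
the nonempty proper faces of the dome. -/
def normalComplex (H : MaxPoly d) : Set (Set (Fin d → ℝ)) :=
  {σ | ∃ F, IsExposed ℝ (maxDome H) F ∧ F.Nonempty ∧ F ≠ maxDome H ∧ σ = Prod.fst '' F}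

/-- The dimension of (the affine hull of) a set in `ℝ^d`. -/
def affDim (C : Set (Fin d → ℝ)) : ℕ := Module.finrank ℝ (vectorSpan ℝ C)

/-- The polytopal complex `S` is dual to the hypersurface of `H`: the hypersurface is the
codimension-one skeleton of the normal complex of `H`, and there is an inclusion-reversing bijection
from the cells of the normal complex to the cells of `S`, with complementary dimensions. It sends
`σ` to the convex hull of the exponents which attain the maximum on all of `σ`. -/
def IsDualToHypersurface (S : Set (Set (Fin d → ℝ))) (H : MaxPoly d) : Prop :=
  maxHypersurface H = ⋃₀ {σ | σ ∈ normalComplex H ∧ affDim σ < d} ∧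
  ∃ φ : normalComplex H ≃o Sᵒᵈ, ∀ σ : normalComplex H,
    (OrderDual.ofDual (φ σ)).1 =
      convexHull ℝ (latticePt '' {m | ∀ x ∈ (σ : Set (Fin d → ℝ)), m ∈ maximizers H x}) ∧
    affDim (σ : Set (Fin d → ℝ)) + affDim (OrderDual.ofDual (φ σ)).1 = d

end TropCayley

end

/-!
Everything is read off from minimal terms. For a min-tropical polynomial `F` and a slope `x`, let
`minimizers F x` be the set of exponents `m` in the support at which `c_m - m · x` is minimal. A
linear functional exposing a nonempty bounded face of a lifted polyhedron has a strictly negative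
vertical component, so the cells of a regular subdivision are the hulls of the points that are lowest
in a non-vertical direction (`regularSubdivision_eq_range`). In particular the cells of `Σ(F)` are the
sets `conv (minimizers F x)`.

For the first two parts, the minimizers of a product are the Minkowski sum of the minimizers of the
factors (`minimizers_prod`). A direction on the Cayley polytope consists of a slope `x` and a
functional on the second factor. Since the `u k` are affinely independent, the latter shifts the
heights over the individual `u k` arbitrarily, so that the minima of all factors can be made equal.
Conversely, the part of a Cayley cell over `u k` is the hull of its `k`-th label, because the `k`-th
barycentric coordinate is maximal exactly there. Hence the mixed labels are the families of subsets
with the same hulls as `minimizers (F k) x`, for a common `x` (`isMixedLabel_iff`).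

For duality, negation of coefficients is a semiring homomorphism which carries the product of the
columns of `V` to the product `H` of the columns of `-V` and minimizers to maximizers. A proper face
of the dome of `H` is the set of maximum points of `f - c H`, with `f` linear and `c > 0`. If `x₀` is
such a point with as few maximal terms as possible, this set is the stratum
`{y | maximizers H x₀ ⊆ maximizers H y}`: maximizers intersect at midpoints of maximum points, and
`f - c H` is affine along the segment from a point of the stratum to a point slightly beyond `x₀`.
Every stratum occurs (`normalComplex_eq_range`). Strata and dual cells are thus both parametrized by
the sets `maximizers H x`, ordered by reverse inclusion and by inclusion, and their directions are
orthogonal complements of each other (`vectorSpan_stratum`).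
-/

noncomputable section

namespace TropCayley

variable {d n : ℕ}

/-! ### Regular subdivisions through linear functionals -/

section Regular

/-- A point of a convex hull at which an affine functional `g`, bounded by `M` on the generators,
attains `M` is a convex combination of the generators at which `g` attains `M`. -/
theorem mem_convexHull_of_le_apply {E : Type*} [AddCommGroup E] [Module ℝ E] {s : Set E}
    (g : E →ᵃ[ℝ] ℝ) {M : ℝ} (hs : ∀ b ∈ s, g b ≤ M) {a : E} (ha : a ∈ convexHull ℝ s)
    (hga : M ≤ g a) : a ∈ convexHull ℝ {b ∈ s | g b = M} := by
  suffices h : convexHull ℝ s ⊆ {a | g a ≤ M ∧ (g a = M → a ∈ convexHull ℝ {b ∈ s | g b = M})} from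
    (h ha).2 ((h ha).1.antisymm hga)
  refine convexHull_min (fun b hb => ⟨hs b hb, fun h => subset_convexHull ℝ _ ⟨hb, h⟩⟩) ?_
  rw [convex_iff_forall_pos]
  rintro x ⟨hx, hx'⟩ y ⟨hy, hy'⟩ t r ht hr htr
  have hg : g (t • x + r • y) = t * g x + r * g y := by
    simpa using Convex.combo_affine_apply htr (f := g) (x := x) (y := y)
  have h1 : t * g x ≤ t * M := mul_le_mul_of_nonneg_left hx ht.le
  have h2 : r * g y ≤ r * M := mul_le_mul_of_nonneg_left hy hr.le
  have h3 : t * M + r * M = M := by rw [← add_mul, htr, one_mul]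
  refine ⟨by rw [hg]; linarith, fun h => ?_⟩
  rw [hg] at h
  exact convex_convexHull ℝ _ (hx' (mul_left_cancel₀ ht.ne' (by linarith)))
    (hy' (mul_left_cancel₀ hr.ne' (by linarith))) ht.le hr.le htr

variable {ι E : Type*} [NormedAddCommGroup E] [NormedSpace ℝ E]

/-- The indices at which the lifted configuration is lowest in the direction `(-f, 1)`. -/
def lowestIndices (p : ι → E) (h : ι → ℝ) (f : E →L[ℝ] ℝ) : Set ι :=
  {i | ∀ j, h i - f (p i) ≤ h j - f (p j)}

theorem lowestIndices_nonempty [Finite ι] [Nonempty ι] (p : ι → E) (h : ι → ℝ)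
    (f : E →L[ℝ] ℝ) : (lowestIndices p h f).Nonempty :=
  Finite.exists_min fun i => h i - f (p i)

/-- The face of the lifted polyhedron in the direction `(-f, 1)` is the convex hull of its lowest
points. -/
theorem lowerFace_eq_convexHull [Finite ι] [Nonempty ι] (p : ι → E) (h : ι → ℝ)
    (f : E →L[ℝ] ℝ) :
    {x ∈ liftedPolyhedron p h | ∀ y ∈ liftedPolyhedron p h, f y.1 - y.2 ≤ f x.1 - x.2} =
      convexHull ℝ ((fun i => (p i, h i)) '' lowestIndices p h f) := by
  obtain ⟨i₀, hi₀⟩ := lowestIndices_nonempty p h f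
  set M := f (p i₀) - h i₀ with hM
  let g : E × ℝ →ₗ[ℝ] ℝ := f.toLinearMap ∘ₗ LinearMap.fst ℝ E ℝ - LinearMap.snd ℝ E ℝ
  have hg : ∀ x, g x = f x.1 - x.2 := fun x => rfl
  have hgen : ∀ i, g (p i, h i) ≤ M := fun i => by
    have := hi₀ i
    simp only [hg]; linarith
  have hhull : ∀ a ∈ convexHull ℝ (range fun i => (p i, h i)), g a ≤ M := fun a ha =>
    convexHull_min (t := {a | g a ≤ M}) (by rintro _ ⟨i, rfl⟩; exact hgen i)
      (convex_halfSpace_le g.isLinear M) ha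
  have hsub : convexHull ℝ (range fun i => (p i, h i)) ⊆ liftedPolyhedron p h := fun a ha =>
    ⟨a, ha, 0, ⟨rfl, le_rfl⟩, add_zero a⟩
  ext x
  constructor
  · rintro ⟨⟨a, ha, ⟨r₁, r⟩, ⟨hr₁, hr⟩, rfl⟩, hmax⟩
    obtain rfl : r₁ = 0 := hr₁
    have h1 := hmax _ (hsub (subset_convexHull ℝ _ ⟨i₀, rfl⟩))
    have h2 := hhull a ha
    simp only [hg, Prod.fst_add, Prod.snd_add, add_zero] at h1 h2 hr
    obtain rfl : r = 0 := by linarith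
    have h3 := mem_convexHull_of_le_apply (M := M) g.toAffineMap
      (by rintro _ ⟨i, rfl⟩; exact hgen i) ha (by simp only [LinearMap.coe_toAffineMap, hg]; linarith)
    rw [show (fun x y : E × ℝ => x + y) a (0, 0) = a from add_zero a]
    refine convexHull_mono ?_ h3
    rintro _ ⟨⟨i, rfl⟩, hi⟩
    refine ⟨i, fun j => ?_, rfl⟩
    have := hgen j
    simp only [LinearMap.coe_toAffineMap, hg] at hi this
    linarith
  · intro hx
    have hx' : x ∈ convexHull ℝ (range fun i => (p i, h i)) :=
      convexHull_mono (image_subset_range _ _) hx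
    refine ⟨hsub hx', ?_⟩
    have hxM : M ≤ g x := by
      refine convexHull_min (t := {a | M ≤ g a}) ?_ (convex_halfSpace_ge g.isLinear M) hx
      rintro _ ⟨i, hi, rfl⟩
      have := hi i₀
      simp only [mem_ofPred_eq, hg]; linarith
    rintro _ ⟨a, ha, ⟨r₁, r⟩, ⟨hr₁, hr⟩, rfl⟩
    obtain rfl : r₁ = 0 := hr₁
    have h2 := hhull a ha
    simp only [hg, Prod.fst_add, Prod.snd_add, add_zero] at h2 hxM hr ⊢
    linarith

/-- The cells of a regular subdivision are the convex hulls of the points that are lowest in some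
non-vertical direction. -/
theorem regularSubdivision_eq_range [Finite ι] [Nonempty ι] (p : ι → E) (h : ι → ℝ) :
    regularSubdivision p h = range fun f => convexHull ℝ (p '' lowestIndices p h f) := by
  have hproj : ∀ f, Prod.fst '' convexHull ℝ ((fun i => (p i, h i)) '' lowestIndices p h f) =
      convexHull ℝ (p '' lowestIndices p h f) := fun f => by
    have := (LinearMap.fst ℝ E ℝ).image_convexHull ((fun i => (p i, h i)) '' lowestIndices p h f)
    rw [image_image] at this
    exact this
  ext C
  constructor
  · rintro ⟨F, hF, hFne, hFb, rfl⟩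
    obtain ⟨l, rfl⟩ := hF hFne
    obtain ⟨x, hxP, hxmax⟩ := hFne
    have hray : ∀ r : ℝ, 0 ≤ r → x + (0, r) ∈ liftedPolyhedron p h := by
      obtain ⟨a, ha, s, ⟨hs₁, hs⟩, rfl⟩ := hxP
      intro r hr
      exact ⟨a, ha, s + (0, r), ⟨by simp [hs₁], by simpa using add_nonneg hs hr⟩,
        (add_assoc _ _ _).symm⟩
    have hl : ∀ q : E × ℝ, l q = l (q.1, 0) + q.2 * l (0, 1) := fun q => by
      rw [← smul_eq_mul, ← map_smul, ← map_add]; simp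
    set c := l (0, 1) with hc
    have hc1 : c ≤ 0 := by
      have := hxmax _ (hray 1 zero_le_one)
      rw [map_add] at this
      linarith
    have hc0 : c ≠ 0 := by
      intro hc0
      -- A vertical functional is constant along upward rays, which would lie in the bounded face.
      obtain ⟨R, hR⟩ := hFb.exists_norm_le
      have hmem := hR (x + (0, |R| + 1 + |x.2|)) ⟨hray _ (by positivity), fun y hy => by
        rw [map_add, hl (0, _)]
        simpa [hc0, show ((0 : E), (0 : ℝ)) = 0 from rfl] using hxmax y hy⟩
      have h2 := (norm_snd_le _).trans hmem
      simp only [Prod.snd_add, Real.norm_eq_abs] at h2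
      have h3 := (abs_le.1 h2).2
      have := neg_abs_le x.2
      have := le_abs_self R
      have := le_abs_self (x.2 + (|R| + 1 + |x.2|))
      linarith
    have hcneg : c < 0 := lt_of_le_of_ne hc1 hc0
    refine ⟨(-c)⁻¹ • l.comp (ContinuousLinearMap.inl ℝ E ℝ), ?_⟩
    beta_reduce
    rw [← hproj, ← lowerFace_eq_convexHull]
    have hscale : ∀ q : E × ℝ,
        ((-c)⁻¹ • l.comp (ContinuousLinearMap.inl ℝ E ℝ)) q.1 - q.2 = (-c)⁻¹ * l q := fun q => by
      rw [hl q]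
      simp only [smul_apply, ContinuousLinearMap.comp_apply,
        ContinuousLinearMap.inl_apply, smul_eq_mul]
      field_simp
      ring
    simp only [hscale]
    congr! 5 with y
    simp only [mul_le_mul_iff_right₀ (inv_pos.2 (neg_pos.2 hcneg))]
  · rintro ⟨f, rfl⟩
    refine ⟨_, fun _ => ⟨f.comp (ContinuousLinearMap.fst ℝ E ℝ) - ContinuousLinearMap.snd ℝ E ℝ,
      (lowerFace_eq_convexHull p h f).symm⟩, ?_, ?_, (hproj f).symm⟩
    · exact ((lowestIndices_nonempty p h f).image _).convexHull
    · rw [isBounded_convexHull]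
      exact ((toFinite (lowestIndices p h f)).image _).isBounded

end Regular

/-! ### Minimal terms of tropical polynomials -/

theorem coeff_eq_trop_minCoeff {F : MinPoly d} {m : Fin d → ℤ} (hm : m ∈ minSupp F) :
    F.coeff m = Tropical.trop (minCoeff F m : WithTop ℝ) := by
  have h : Tropical.untrop (F.coeff m) ≠ ⊤ := fun h =>
    Finsupp.mem_support_iff.1 hm (Tropical.untrop_injective h)
  obtain ⟨r, hr⟩ := WithTop.ne_top_iff_exists.1 h
  rw [← Tropical.untrop_eq_iff_eq_trop, minCoeff, ← hr]
  rfl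

open Classical in
theorem untrop_coeff_mul (F G : MinPoly d) (m : Fin d → ℤ) :
    Tropical.untrop ((F * G).coeff m) =
      ((minSupp F ×ˢ minSupp G).filter fun p => p.1 + p.2 = m).inf
        fun p => ((minCoeff F p.1 + minCoeff G p.2 : ℝ) : WithTop ℝ) := by
  rw [AddMonoidAlgebra.coeff_mul, Finsupp.sum]
  simp only [Finsupp.sum]
  rw [← Finset.sum_product', ← Finset.sum_filter, Finset.untrop_sum']
  refine Finset.inf_congr rfl fun p hp => ?_
  obtain ⟨hF, hG⟩ := Finset.mem_product.1 (Finset.mem_filter.1 hp).1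
  simp [coeff_eq_trop_minCoeff hF, coeff_eq_trop_minCoeff hG]

theorem minCoeff_mul_le {F G : MinPoly d} {a b : Fin d → ℤ} (ha : a ∈ minSupp F)
    (hb : b ∈ minSupp G) :
    a + b ∈ minSupp (F * G) ∧ minCoeff (F * G) (a + b) ≤ minCoeff F a + minCoeff G b := by
  classical
  have h : Tropical.untrop ((F * G).coeff (a + b)) ≤
      ((minCoeff F a + minCoeff G b : ℝ) : WithTop ℝ) := by
    rw [untrop_coeff_mul]
    exact Finset.inf_le (f := fun p : (Fin d → ℤ) × (Fin d → ℤ) =>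
      ((minCoeff F p.1 + minCoeff G p.2 : ℝ) : WithTop ℝ)) (b := (a, b)) (by simp [ha, hb])
  have hmem : a + b ∈ minSupp (F * G) := Finsupp.mem_support_iff.2 fun h0 => by
    rw [h0] at h
    exact absurd h (by simp)
  refine ⟨hmem, ?_⟩
  rw [coeff_eq_trop_minCoeff hmem] at h
  exact WithTop.coe_le_coe.1 h

theorem exists_minCoeff_mul_eq {F G : MinPoly d} {m : Fin d → ℤ} (hm : m ∈ minSupp (F * G)) :
    ∃ a ∈ minSupp F, ∃ b ∈ minSupp G, a + b = m ∧
      minCoeff (F * G) m = minCoeff F a + minCoeff G b := by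
  classical
  have h := untrop_coeff_mul F G m
  rw [coeff_eq_trop_minCoeff hm, Tropical.untrop_trop] at h
  rcases ((minSupp F ×ˢ minSupp G).filter fun p => p.1 + p.2 = m).eq_empty_or_nonempty with hs | hs
  · rw [hs] at h
    exact absurd h (by simp)
  · obtain ⟨p, hp, hpe⟩ := Finset.exists_mem_eq_inf _ hs
      fun p => ((minCoeff F p.1 + minCoeff G p.2 : ℝ) : WithTop ℝ)
    rw [hpe] at h
    simp only [Finset.mem_filter, Finset.mem_product] at hp
    exact ⟨p.1, hp.1.1, p.2, hp.1.2, hp.2, WithTop.coe_injective h⟩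

/-- The height of the exponent `m` of `F` above the hyperplane with slope `x`. -/
def tilt (F : MinPoly d) (x : Fin d → ℝ) (m : Fin d → ℤ) : ℝ :=
  minCoeff F m - ∑ i, (m i : ℝ) * x i

/-- The exponents of `F` of minimal height above the hyperplane with slope `x`. Equivalently, these
are the exponents of the terms of `F` that are minimal at the point `-x`. -/
def minimizers (F : MinPoly d) (x : Fin d → ℝ) : Set (Fin d → ℤ) :=
  {m | m ∈ minSupp F ∧ ∀ m' ∈ minSupp F, tilt F x m ≤ tilt F x m'}

theorem minimizers_nonempty {F : MinPoly d} (hF : (minSupp F).Nonempty) (x : Fin d → ℝ) :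
    (minimizers F x).Nonempty :=
  Finset.exists_min_image (minSupp F) (tilt F x) hF

theorem minimizers_mul (F G : MinPoly d) (x : Fin d → ℝ) :
    minimizers (F * G) x = minimizers F x + minimizers G x := by
  have hsum : ∀ a b : Fin d → ℤ, ∑ i, ((a + b) i : ℝ) * x i =
      ∑ i, (a i : ℝ) * x i + ∑ i, (b i : ℝ) * x i := fun a b => by
    simp [add_mul, Finset.sum_add_distrib]
  have hle : ∀ {a b}, a ∈ minSupp F → b ∈ minSupp G →
      tilt (F * G) x (a + b) ≤ tilt F x a + tilt G x b := fun {a b} ha hb => by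
    have := (minCoeff_mul_le ha hb).2
    simp only [tilt, hsum]
    linarith
  have heq : ∀ {m}, m ∈ minSupp (F * G) → ∃ a ∈ minSupp F, ∃ b ∈ minSupp G, a + b = m ∧
      tilt (F * G) x m = tilt F x a + tilt G x b := fun {m} hm => by
    obtain ⟨a, ha, b, hb, rfl, h⟩ := exists_minCoeff_mul_eq hm
    refine ⟨a, ha, b, hb, rfl, ?_⟩
    simp only [tilt, hsum]
    linarith
  ext m
  constructor
  · rintro ⟨hm, hmin⟩
    obtain ⟨a, ha, b, hb, rfl, h⟩ := heq hm
    refine ⟨a, ⟨ha, fun a' ha' => ?_⟩, b, ⟨hb, fun b' hb' => ?_⟩, rfl⟩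
    · have := hmin _ (minCoeff_mul_le ha' hb).1
      have := hle ha' hb
      linarith
    · have := hmin _ (minCoeff_mul_le ha hb').1
      have := hle ha hb'
      linarith
  · rintro ⟨a, ⟨ha, ha'⟩, b, ⟨hb, hb'⟩, rfl⟩
    refine ⟨(minCoeff_mul_le ha hb).1, fun m' hm' => ?_⟩
    obtain ⟨a', ha'', b', hb'', rfl, h⟩ := heq hm'
    have := hle ha hb
    have := ha' _ ha''
    have := hb' _ hb''
    linarith

theorem minSupp_one : minSupp (1 : MinPoly d) = {0} := by
  classical
  ext m
  simp [minSupp, AddMonoidAlgebra.one_def, eq_comm]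

theorem minSupp_prod_nonempty {κ : Type*} (s : Finset κ) {F : κ → MinPoly d}
    (hF : ∀ k, (minSupp (F k)).Nonempty) : (minSupp (∏ k ∈ s, F k)).Nonempty := by
  classical
  induction s using Finset.induction_on with
  | empty => simp [minSupp_one]
  | insert k s hk ih =>
    rw [Finset.prod_insert hk]
    obtain ⟨a, ha⟩ := hF k
    obtain ⟨b, hb⟩ := ih
    exact ⟨_, (minCoeff_mul_le ha hb).1⟩

/-- The minimizers of a product form the Minkowski sum of the minimizers of the factors. -/
theorem minimizers_prod {κ : Type*} (s : Finset κ) (F : κ → MinPoly d) (x : Fin d → ℝ) :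
    minimizers (∏ k ∈ s, F k) x = ∑ k ∈ s, minimizers (F k) x := by
  classical
  induction s using Finset.induction_on with
  | empty =>
    ext m
    simp +contextual [minimizers, minSupp_one]
  | insert k s hk ih =>
    rw [Finset.prod_insert hk, Finset.sum_insert hk,
minimizers_mul, ih]

theorem minSupp_minLinearForm_nonempty {v : Fin d → WithTop ℝ} (hv : ∃ i, v i ≠ ⊤) :
    (minSupp (minLinearForm v)).Nonempty := by
  classical
  obtain ⟨i, hi⟩ := hv
  refine ⟨Pi.single i 1, Finsupp.mem_support_iff.2 ?_⟩
  have hne : ∀ j, (Pi.single j 1 : Fin d → ℤ) = Pi.single i 1 ↔ j = i := fun j => by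
    constructor
    · intro h
      by_contra hji
      have := congrFun h j
      simp [hji] at this
    · rintro rfl; rfl
  have h : (minLinearForm v).coeff (Pi.single i 1) = Tropical.trop (v i) := by
    simp [minLinearForm, Finsupp.finsetSum_apply, Finsupp.single_apply, hne]
  rw [h]
  exact fun h0 => hi (Tropical.trop_injective h0)

/-! ### Passing between the min and the max convention -/

/-- Negation as a semiring homomorphism from the min-tropical to the max-tropical numbers. -/
def negTropHom : MinTropical →+* MaxTropical where
  toFun a := Tropical.trop (negTrop (Tropical.untrop a))
  map_one' := by
    change Tropical.trop (negTrop ((0 : ℝ) : WithTop ℝ)) = 1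
    simp only [negTrop, WithTop.map_coe, neg_zero]
    rfl
  map_zero' := rfl
  map_mul' a b := by
    apply Tropical.untrop_injective
    change negTrop (Tropical.untrop a + Tropical.untrop b) =
      negTrop (Tropical.untrop a) + negTrop (Tropical.untrop b)
    generalize Tropical.untrop a = a, Tropical.untrop b = b
    induction a with
    | top => simp [negTrop]
    | coe a =>
      induction b with
      | top => simp [negTrop]
      | coe b =>
        rw [← WithTop.coe_add]
        change ((OrderDual.toDual (-(a + b)) : ℝᵒᵈ) : WithTop ℝᵒᵈ) = _
        rw [neg_add]
        rfl
  map_add' a b := by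
    apply Tropical.untrop_injective
    have hmono : Monotone negTrop := by
      refine WithTop.monotone_map_iff.2 fun r s hrs => ?_
      exact OrderDual.toDual_le_toDual.2 (neg_le_neg hrs)
    exact hmono.map_min

theorem map_columnProduct (V : Matrix (Fin d) (Fin n) (WithTop ℝ)) :
    AddMonoidAlgebra.mapRingHom _ negTropHom (columnProduct V) = negColumnProduct V := by
  simp only [columnProduct, negColumnProduct, minLinearForm, negMaxLinearForm, map_prod, map_sum,
    AddMonoidAlgebra.mapRingHom_single]
  rfl

theorem maxSupp_map (F : MinPoly d) :
    maxSupp (AddMonoidAlgebra.mapRingHom _ negTropHom F) = minSupp F := by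
  ext m
  simp only [maxSupp, minSupp, Finsupp.mem_support_iff, AddMonoidAlgebra.coeff_mapRingHom]
  refine not_congr ?_
  rw [← Tropical.untrop_inj_iff, ← Tropical.untrop_inj_iff, Tropical.untrop_zero,
    Tropical.untrop_zero]
  exact WithTop.map_eq_top_iff

theorem maxCoeff_map {F : MinPoly d} {m : Fin d → ℤ} (hm : m ∈ minSupp F) :
    maxCoeff (AddMonoidAlgebra.mapRingHom _ negTropHom F) m = -minCoeff F m := by
  rw [maxCoeff, AddMonoidAlgebra.coeff_mapRingHom, coeff_eq_trop_minCoeff hm]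
  rfl

theorem maximizers_map (F : MinPoly d) (x : Fin d → ℝ) :
    maximizers (AddMonoidAlgebra.mapRingHom _ negTropHom F) x = minimizers F x := by
  ext m
  simp only [maximizers, minimizers, maxSupp_map]
  refine and_congr_right fun hm => forall₂_congr fun m' hm' => ?_
  simp only [maxTerm, tilt, maxCoeff_map hm, maxCoeff_map hm']
  constructor <;> intro h <;> linarith

/-! ### Subdivisions of tropical polynomials -/

theorem polySubdivision_eq_range {F : MinPoly d} (hF : (minSupp F).Nonempty) :
    polySubdivision F = range fun x => convexHull ℝ (latticePt '' minimizers F x) := by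
  have : Nonempty {m // m ∈ minSupp F} := hF.to_subtype
  have himage : ∀ f : (Fin d → ℝ) →L[ℝ] ℝ, ∀ x : Fin d → ℝ, (∀ y, f y = ∑ i, y i * x i) →
      (fun m : {m // m ∈ minSupp F} => latticePt m.1) '' lowestIndices
        (fun m : {m // m ∈ minSupp F} => latticePt m.1) (fun m => minCoeff F m.1) f =
      latticePt '' minimizers F x := by
    intro f x hf
    ext q
    simp only [lowestIndices, minimizers, tilt, hf, latticePt, mem_image, mem_ofPred_eq,
      Subtype.forall, Subtype.exists]
    constructor
    · rintro ⟨m, hm, h, rfl⟩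
      exact ⟨m, ⟨hm, h⟩, rfl⟩
    · rintro ⟨m, ⟨hm, h⟩, rfl⟩
      exact ⟨m, hm, h, rfl⟩
  rw [polySubdivision, regularSubdivision_eq_range]
  ext C
  constructor
  · rintro ⟨f, rfl⟩
    refine ⟨fun i => f (Pi.single i 1), ?_⟩
    beta_reduce
    rw [himage f _ fun y => ?_]
    conv_lhs => rw [pi_eq_sum_univ' y, map_sum]
    simp
  · rintro ⟨x, rfl⟩
    refine ⟨∑ i, x i • ContinuousLinearMap.proj i, ?_⟩
    beta_reduce
    rw [himage _ x fun y => ?_]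
    simp [mul_comm]

/-! ### Cayley cells and mixed cells -/

theorem latticePt_sum {κ : Type*} (s : Finset κ) (a : κ → Fin d → ℤ) :
    latticePt (∑ k ∈ s, a k) = ∑ k ∈ s, latticePt (a k) := by
  ext i
  simp [latticePt, Finset.sum_apply]

/-- The Cayley set `⋃ k, A k × {u k}`, for arbitrary sets of exponents. -/
def cayleySet {W : Type*} (u : Fin n → W) (A : Fin n → Set (Fin d → ℤ)) :
    Set ((Fin d → ℝ) × W) :=
  {q | ∃ k, ∃ m ∈ A k, q = (latticePt m, u k)}

section Cayley

variable {W : Type*} [NormedAddCommGroup W] [NormedSpace ℝ W]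

/-- The part of the hull of a Cayley set over the vertex `u k` is the hull of the `k`-th set: the
`k`-th barycentric coordinate attains its maximum `1` exactly there. -/
theorem mem_convexHull_cayleySet (u : AffineBasis (Fin n) ℝ W) (A : Fin n → Set (Fin d → ℤ))
    (k : Fin n) (q : Fin d → ℝ) :
    (q, u k) ∈ convexHull ℝ (cayleySet u A) ↔ q ∈ convexHull ℝ (latticePt '' A k) := by
  have hprod : convexHull ℝ ((latticePt '' A k) ×ˢ {u k}) =
      convexHull ℝ (latticePt '' A k) ×ˢ {u k} := by
    rw [convexHull_prod, convexHull_singleton]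
  constructor
  · intro h
    let g : ((Fin d → ℝ) × W) →ᵃ[ℝ] ℝ :=
      (u.coord k).comp (LinearMap.snd ℝ (Fin d → ℝ) W).toAffineMap
    have hg : ∀ x, g x = u.coord k x.2 := fun x => rfl
    have h2 := mem_convexHull_of_le_apply (M := 1) g (by
      rintro _ ⟨j, m, -, rfl⟩
      rw [hg, u.coord_apply]
      split_ifs <;> norm_num) h (by rw [hg, u.coord_apply_eq])
    have h3 : (q, u k) ∈ convexHull ℝ ((latticePt '' A k) ×ˢ {u k}) := by
      refine convexHull_mono ?_ h2
      rintro _ ⟨⟨j, m, hm, rfl⟩, hj⟩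
      rw [hg, u.coord_apply] at hj
      obtain rfl : k = j := by
        by_contra hkj
        simp [hkj] at hj
      exact ⟨⟨m, hm, rfl⟩, rfl⟩
    rw [hprod] at h3
    exact h3.1
  · intro h
    have h3 : (q, u k) ∈ convexHull ℝ ((latticePt '' A k) ×ˢ {u k}) := by
      rw [hprod]
      exact ⟨h, rfl⟩
    refine convexHull_mono ?_ h3
    rintro ⟨_, _⟩ ⟨⟨m, hm, rfl⟩, rfl⟩
    exact ⟨k, m, hm, rfl⟩

theorem convexHull_cayleySet_eq_iff (u : AffineBasis (Fin n) ℝ W)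
    (A B : Fin n → Set (Fin d → ℤ)) :
    convexHull ℝ (cayleySet u A) = convexHull ℝ (cayleySet u B) ↔
      ∀ k, convexHull ℝ (latticePt '' A k) = convexHull ℝ (latticePt '' B k) := by
  constructor
  · intro h k
    ext q
    rw [← mem_convexHull_cayleySet u, h, mem_convexHull_cayleySet]
  · have hle : ∀ A B : Fin n → Set (Fin d → ℤ),
        (∀ k, convexHull ℝ (latticePt '' A k) = convexHull ℝ (latticePt '' B k)) →
        convexHull ℝ (cayleySet u A) ⊆ convexHull ℝ (cayleySet u B) := by
      refine fun A B h => convexHull_min ?_ (convex_convexHull ℝ _)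
      rintro _ ⟨k, m, hm, rfl⟩
      rw [mem_convexHull_cayleySet, ← h k]
      exact subset_convexHull ℝ _ ⟨m, hm, rfl⟩
    exact fun h => (hle A B h).antisymm (hle B A fun k => (h k).symm)

theorem cayleyCell_eq (u : Fin n → W) (A : Fin n → Finset (Fin d → ℤ)) :
    cayleyCell u A = convexHull ℝ (cayleySet u fun k => (A k : Set (Fin d → ℤ))) := rfl

theorem cayleyConfig_image_lowestIndices (u : Fin n → W) (F : Fin n → MinPoly d)
    (f : ((Fin d → ℝ) × W) →L[ℝ] ℝ) :
    (fun x : (Σ k, {m // m ∈ minSupp (F k)}) => (latticePt x.2.1, u x.1)) '' lowestIndices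
      (fun x : (Σ k, {m // m ∈ minSupp (F k)}) => (latticePt x.2.1, u x.1))
      (fun x => minCoeff (F x.1) x.2.1) f =
    cayleySet u fun k => {m | m ∈ minSupp (F k) ∧ ∀ j, ∀ m' ∈ minSupp (F j),
      minCoeff (F k) m - f (latticePt m, u k) ≤ minCoeff (F j) m' - f (latticePt m', u j)} := by
  ext q
  constructor
  · rintro ⟨⟨k, m, hm⟩, h, rfl⟩
    exact ⟨k, m, ⟨hm, fun j m' hm' => h ⟨j, m', hm'⟩⟩, rfl⟩
  · rintro ⟨k, m, ⟨hm, h⟩, rfl⟩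
    exact ⟨⟨k, m, hm⟩, fun ⟨j, m', hm'⟩ => h j m' hm', rfl⟩

/-- A linear functional on `ℝ^d × W` in coordinates on the first factor. -/
theorem apply_latticePt_prod (f : ((Fin d → ℝ) × W) →L[ℝ] ℝ) (m : Fin d → ℤ) (w : W) :
    f (latticePt m, w) = ∑ i, (m i : ℝ) * f (Pi.single i 1, 0) + f (0, w) := by
  have h1 : f (latticePt m, w) = f (latticePt m, 0) + f (0, w) := by
    rw [← map_add]; simp
  have h2 : f (latticePt m, 0) = (f.comp (ContinuousLinearMap.inl ℝ (Fin d → ℝ) W)) (latticePt m) :=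
    rfl
  rw [h1, h2, pi_eq_sum_univ' (latticePt m), map_sum]
  simp [latticePt]

/-- Nonempty subsets of the supports label a mixed cell exactly if, for a common direction `x`, each
of them has the same hull as the corresponding set of minimizers. -/
theorem isMixedLabel_iff [FiniteDimensional ℝ W] (hn : 0 < n) (u : AffineBasis (Fin n) ℝ W)
    {F : Fin n → MinPoly d} (hF : ∀ k, (minSupp (F k)).Nonempty) (A : Fin n → Finset (Fin d → ℤ)) :
    IsMixedLabel u F A ↔ (∀ k, A k ⊆ minSupp (F k)) ∧ ∃ x, ∀ k,
      convexHull ℝ (latticePt '' (A k : Set (Fin d → ℤ))) =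
        convexHull ℝ (latticePt '' minimizers (F k) x) := by
  have : Nonempty (Σ k, {m // m ∈ minSupp (F k)}) := ⟨⟨⟨0, hn⟩, _, (hF ⟨0, hn⟩).choose_spec⟩⟩
  rw [IsMixedLabel, cayleySubdivision, regularSubdivision_eq_range, cayleyCell_eq]
  simp only [cayleyConfig_image_lowestIndices]
  refine and_congr_right fun _ => ?_
  constructor
  · rintro ⟨hA, f, hf⟩
    refine ⟨fun i => f (Pi.single i 1, 0), fun k => ?_⟩
    have hk := ((convexHull_cayleySet_eq_iff u _ _).1 hf k).symm
    rw [hk]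
    have hne := ((hA k).to_set.image latticePt).convexHull (𝕜 := ℝ)
    rw [hk, convexHull_nonempty_iff, image_nonempty] at hne
    obtain ⟨m₀, hm₀, h₀⟩ := hne
    congr 2
    ext m
    simp only [minimizers, tilt, mem_ofPred_eq]
    refine and_congr_right fun hm => ⟨fun h m' hm' => ?_, fun h j m' hm' => ?_⟩
    · have := h k m' hm'
      simp only [apply_latticePt_prod] at this
      linarith
    · refine le_trans ?_ (h₀ j m' hm')
      have := h m₀ hm₀
      simp only [apply_latticePt_prod]
      linarith
  · rintro ⟨x, hx⟩
    refine ⟨fun k => ?_, ?_⟩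
    · have hne := ((minimizers_nonempty (hF k) x).image latticePt).convexHull (𝕜 := ℝ)
      rw [← hx k, convexHull_nonempty_iff, image_nonempty] at hne
      exact hne
    · choose m₀ hm₀ using fun k => minimizers_nonempty (hF k) x
      -- The component along `W` is chosen so that all the factors get the same minimum.
      let g : W →ᵃ[ℝ] ℝ := ∑ k, tilt (F k) x (m₀ k) • u.coord k
      have hg : ∀ k, g (u k) = tilt (F k) x (m₀ k) := fun k => by
        have hcoe : ∀ s : Finset (Fin n), (∑ j ∈ s, tilt (F j) x (m₀ j) • u.coord j) (u k) =
            ∑ j ∈ s, tilt (F j) x (m₀ j) * u.coord j (u k) := fun s => by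
          induction s using Finset.induction_on with
          | empty => simp
          | insert j s hj ih => simp [Finset.sum_insert hj, ih]
        simp [g, hcoe, u.coord_apply]
      have hlin : ∀ w, g w = g.linear w + g 0 := fun w => by
        simpa using g.map_vadd 0 w
      let f : ((Fin d → ℝ) × W) →L[ℝ] ℝ :=
        LinearMap.toContinuousLinearMap
          ((∑ i, x i • LinearMap.proj i : (Fin d → ℝ) →ₗ[ℝ] ℝ).coprod g.linear)
      have hf : ∀ k m, minCoeff (F k) m - f (latticePt m, u k) =
          tilt (F k) x m - tilt (F k) x (m₀ k) + g 0 := fun k m => by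
        have : f (latticePt m, u k) = ∑ i, (m i : ℝ) * x i + g.linear (u k) := by
          simp [f, latticePt, mul_comm]
        rw [this, ← hg, hlin (u k), tilt]
        ring
      refine ⟨f, ?_⟩
      have hB : (fun k => {m | m ∈ minSupp (F k) ∧ ∀ j, ∀ m' ∈ minSupp (F j),
          minCoeff (F k) m - f (latticePt m, u k) ≤ minCoeff (F j) m' - f (latticePt m', u j)}) =
          fun k => minimizers (F k) x := by
        funext k
        ext m
        simp only [hf]
        refine and_congr_right fun hm => ⟨fun h m' hm' => ?_, fun h j m' hm' => ?_⟩
        · have := h k _ (hm₀ k).1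
          have := (hm₀ k).2 m' hm'
          linarith
        · have := h _ (hm₀ k).1
          have := (hm₀ j).2 m' hm'
          linarith
      beta_reduce
      rw [hB, convexHull_cayleySet_eq_iff]
      exact fun k => (hx k).symm

end Cayley

theorem minkowskiCell_eq_sum (A : Fin n → Finset (Fin d → ℤ)) :
    minkowskiCell A = ∑ k, convexHull ℝ (latticePt '' (A k : Set (Fin d → ℤ))) := by
  rw [← convexHull_sum, minkowskiCell]
  congr 1
  ext q
  simp only [Set.mem_fintype_sum, mem_ofPred_eq]
  constructor
  · rintro ⟨a, ha, rfl⟩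
    exact ⟨fun k => latticePt (a k), fun k => ⟨a k, ha k, rfl⟩, rfl⟩
  · rintro ⟨b, hb, rfl⟩
    choose a ha hab using hb
    exact ⟨a, ha, by simp [hab]⟩

theorem convexHull_minimizers_prod (F : Fin n → MinPoly d) (x : Fin d → ℝ) :
    convexHull ℝ (latticePt '' minimizers (∏ k, F k) x) =
      ∑ k, convexHull ℝ (latticePt '' minimizers (F k) x) := by
  rw [minimizers_prod, ← convexHull_sum]
  congr 1
  ext q
  simp only [mem_image, Set.mem_fintype_sum]
  constructor
  · rintro ⟨_, ⟨a, ha, rfl⟩, rfl⟩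
    exact ⟨fun k => latticePt (a k), fun k => ⟨a k, ha k, rfl⟩, (latticePt_sum _ _).symm⟩
  · rintro ⟨b, hb, rfl⟩
    choose a ha hab using hb
    exact ⟨_, ⟨a, ha, rfl⟩, by simp [latticePt_sum, hab]⟩

/-- The Cayley trick for products of tropical polynomials. -/
theorem polySubdivision_prod_eq_mixedSubdivision {W : Type*} [NormedAddCommGroup W]
    [NormedSpace ℝ W] [FiniteDimensional ℝ W] (hn : 0 < n) (u : AffineBasis (Fin n) ℝ W)
    {F : Fin n → MinPoly d} (hF : ∀ k, (minSupp (F k)).Nonempty) :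
    polySubdivision (∏ k, F k) = mixedSubdivision u F := by
  rw [polySubdivision_eq_range (minSupp_prod_nonempty _ hF)]
  ext C
  simp only [mixedSubdivision, isMixedLabel_iff hn u hF, mem_range, mem_ofPred_eq,
    convexHull_minimizers_prod, minkowskiCell_eq_sum]
  constructor
  · rintro ⟨x, rfl⟩
    have hfin : ∀ k, (minimizers (F k) x).Finite := fun k =>
      (minSupp (F k)).finite_toSet.subset fun m hm => hm.1
    exact ⟨fun k => (hfin k).toFinset, ⟨fun k m hm => ((hfin k).mem_toFinset.1 hm).1, x,
      fun k => by simp⟩, by simp⟩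
  · rintro ⟨A, ⟨-, x, hx⟩, rfl⟩
    exact ⟨x, by simp [hx]⟩

/-! ### The normal complex of a max-tropical polynomial -/

section Normal

variable {H : MaxPoly d}

/-- The value at `x` of a max-tropical polynomial with nonempty support. -/
def maxValue (H : MaxPoly d) (hH : (maxSupp H).Nonempty) (x : Fin d → ℝ) : ℝ :=
  (maxSupp H).sup' hH fun m => maxTerm H m x

theorem maxTerm_le_maxValue (hH : (maxSupp H).Nonempty) {m : Fin d → ℤ} (hm : m ∈ maxSupp H)
    (x : Fin d → ℝ) : maxTerm H m x ≤ maxValue H hH x :=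
  Finset.le_sup' (fun m => maxTerm H m x) hm

theorem maxValue_le_iff (hH : (maxSupp H).Nonempty) {x : Fin d → ℝ} {s : ℝ} :
    maxValue H hH x ≤ s ↔ ∀ m ∈ maxSupp H, maxTerm H m x ≤ s :=
  Finset.sup'_le_iff _ _

theorem mem_maximizers_iff (hH : (maxSupp H).Nonempty) {m : Fin d → ℤ} {x : Fin d → ℝ} :
    m ∈ maximizers H x ↔ m ∈ maxSupp H ∧ maxTerm H m x = maxValue H hH x := by
  refine and_congr_right fun hm => ?_
  rw [← maxValue_le_iff hH]
  exact ⟨fun h => (maxTerm_le_maxValue hH hm x).antisymm h, fun h => h.ge⟩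

theorem maximizers_nonempty (hH : (maxSupp H).Nonempty) (x : Fin d → ℝ) :
    (maximizers H x).Nonempty :=
  Finset.exists_max_image (maxSupp H) (fun m => maxTerm H m x) hH

theorem maximizers_finite (H : MaxPoly d) (x : Fin d → ℝ) : (maximizers H x).Finite :=
  (maxSupp H).finite_toSet.subset fun _ hm => hm.1

theorem maxTerm_add_smul (H : MaxPoly d) (m : Fin d → ℤ) (x z : Fin d → ℝ) (t : ℝ) :
    maxTerm H m (x + t • z) = maxTerm H m x + t * ∑ i, (m i : ℝ) * z i := by
  simp only [maxTerm, Pi.add_apply, Pi.smul_apply, smul_eq_mul, mul_add, Finset.sum_add_distrib,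
    Finset.mul_sum, add_assoc]
  congr 2
  exact Finset.sum_congr rfl fun i _ => by ring

theorem maxTerm_combo (H : MaxPoly d) (m : Fin d → ℤ) (x y : Fin d → ℝ) {t r : ℝ}
    (h : t + r = 1) : maxTerm H m (t • x + r • y) = t * maxTerm H m x + r * maxTerm H m y := by
  simp only [maxTerm, Pi.add_apply, Pi.smul_apply, smul_eq_mul, mul_add, Finset.sum_add_distrib,
    Finset.mul_sum]
  have h1 : ∀ (c : ℝ) (w : Fin d → ℝ), ∑ i, (m i : ℝ) * (c * w i) = ∑ i, c * ((m i : ℝ) * w i) :=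
    fun c w => Finset.sum_congr rfl fun i _ => by ring
  rw [h1, h1]
  linear_combination (-maxCoeff H m) * h

/-- Near `x`, only terms that are maximal at `x` can be maximal. -/
theorem exists_pos_maximizers_add_smul_subset (hH : (maxSupp H).Nonempty) (x z : Fin d → ℝ) :
    ∃ t : ℝ, 0 < t ∧ maximizers H (x + t • z) ⊆ maximizers H x := by
  obtain ⟨m₀, hm₀⟩ := maximizers_nonempty hH x
  have hcont : ∀ m, Continuous fun t : ℝ => maxTerm H m (x + t • z) := fun m => by
    simp only [maxTerm_add_smul]; fun_prop
  have hev : ∀ᶠ t : ℝ in nhds 0, ∀ m ∈ maxSupp H, m ∉ maximizers H x →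
      maxTerm H m (x + t • z) < maxTerm H m₀ (x + t • z) := by
    rw [Filter.eventually_all_finset]
    intro m hm
    by_cases hmx : m ∈ maximizers H x
    · exact Filter.Eventually.of_forall fun t h => absurd hmx h
    · have hlt : maxTerm H m x < maxTerm H m₀ x := by
        by_contra! h
        exact hmx ⟨hm, fun m' hm' => (hm₀.2 m' hm').trans h⟩
      have := (hcont m).continuousAt.eventually_lt (hcont m₀).continuousAt
        (by simpa using hlt : maxTerm H m (x + (0 : ℝ) • z) < maxTerm H m₀ (x + (0 : ℝ) • z))
      exact this.mono fun t h _ => h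
  obtain ⟨t, ht, ht0⟩ := ((hev.filter_mono nhdsWithin_le_nhds).and
    (self_mem_nhdsWithin (s := Ioi (0 : ℝ)))).exists
  refine ⟨t, ht0, fun m hm => ?_⟩
  by_contra hmx
  exact absurd (hm.2 m₀ hm₀.1) (not_le.2 (ht m hm.1 hmx))

/-- The closed stratum of `x`: the points at which all terms maximal at `x` are maximal. -/
def stratum (H : MaxPoly d) (x : Fin d → ℝ) : Set (Fin d → ℝ) :=
  {y | maximizers H x ⊆ maximizers H y}

theorem self_mem_stratum (H : MaxPoly d) (x : Fin d → ℝ) : x ∈ stratum H x :=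
  Subset.refl _

theorem maxValue_combo_le (hH : (maxSupp H).Nonempty) (x y : Fin d → ℝ) {t r : ℝ} (ht : 0 ≤ t)
    (hr : 0 ≤ r) (h : t + r = 1) :
    maxValue H hH (t • x + r • y) ≤ t * maxValue H hH x + r * maxValue H hH y := by
  rw [maxValue_le_iff]
  intro m hm
  rw [maxTerm_combo H m x y h]
  exact add_le_add (mul_le_mul_of_nonneg_left (maxTerm_le_maxValue hH hm x) ht)
    (mul_le_mul_of_nonneg_left (maxTerm_le_maxValue hH hm y) hr)

/-- If `f - c H` attains its maximum, then it does so exactly on a stratum. The stratum belongs to a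
maximum point with as few maximal terms as possible. -/
theorem exists_argmax_eq_stratum (hH : (maxSupp H).Nonempty) (f : (Fin d → ℝ) →ₗ[ℝ] ℝ) {c : ℝ}
    (hc : 0 < c)
    (hne : {x | ∀ y, f y - c * maxValue H hH y ≤ f x - c * maxValue H hH x}.Nonempty) :
    ∃ x₀, {x | ∀ y, f y - c * maxValue H hH y ≤ f x - c * maxValue H hH x} = stratum H x₀ := by
  set T := {x | ∀ y, f y - c * maxValue H hH y ≤ f x - c * maxValue H hH x}
  have hmid : ∀ x ∈ T, ∀ y ∈ T, ∃ z ∈ T, maximizers H z ⊆ maximizers H x ∩ maximizers H y := by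
    intro x hx y hy
    have h2 : (1 / 2 : ℝ) + 1 / 2 = 1 := by norm_num
    have hv := maxValue_combo_le hH x y (by norm_num) (by norm_num) h2
    have hf : f ((1 / 2 : ℝ) • x + (1 / 2 : ℝ) • y) = 1 / 2 * f x + 1 / 2 * f y := by
      simp only [map_add, map_smul, smul_eq_mul]
    have hcv := mul_le_mul_of_nonneg_left hv hc.le
    have hxy := hx y
    have hyx := hy x
    refine ⟨(1 / 2 : ℝ) • x + (1 / 2 : ℝ) • y, fun w => ?_, fun m hm => ?_⟩
    · have := hx w
      rw [hf]
      linarith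
    · have hz := hx ((1 / 2 : ℝ) • x + (1 / 2 : ℝ) • y)
      rw [hf] at hz
      have hv' : 1 / 2 * maxValue H hH x + 1 / 2 * maxValue H hH y ≤
          maxValue H hH ((1 / 2 : ℝ) • x + (1 / 2 : ℝ) • y) :=
        le_of_mul_le_mul_left (by linarith) hc
      rw [mem_maximizers_iff hH, maxTerm_combo H m x y h2] at hm
      have := maxTerm_le_maxValue hH hm.1 x
      have := maxTerm_le_maxValue hH hm.1 y
      exact ⟨(mem_maximizers_iff hH).2 ⟨hm.1, by linarith⟩,
        (mem_maximizers_iff hH).2 ⟨hm.1, by linarith⟩⟩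
  obtain ⟨x₀, hx₀, hmin⟩ := exists_minimalFor_of_wellFoundedLT (· ∈ T)
    (fun x => (maximizers H x).ncard) hne
  refine ⟨x₀, Subset.antisymm (fun x hx => ?_) fun x hx => ?_⟩
  · obtain ⟨z, hz, hzs⟩ := hmid x₀ hx₀ x hx
    have hz₀ : maximizers H z = maximizers H x₀ :=
      eq_of_subset_of_ncard_le (fun m hm => (hzs hm).1)
        (hmin hz (ncard_le_ncard (fun m hm => (hzs hm).1) (maximizers_finite H x₀)))
        (maximizers_finite H x₀)
    exact fun m hm => (hzs (hz₀ ▸ hm)).2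
  · -- Prolong the segment from `x` to `x₀` a little beyond `x₀`: some term of `H` is maximal on all
    -- of it, so that `f - c H` is affine there with its maximum at an interior point.
    obtain ⟨t, ht, hts⟩ := exists_pos_maximizers_add_smul_subset hH x₀ (x₀ - x)
    obtain ⟨m, hm⟩ := maximizers_nonempty hH (x₀ + t • (x₀ - x))
    have hm₀ := hts hm
    have hmx := hx hm₀
    have hz := hx₀ (x₀ + t • (x₀ - x))
    have e := maxTerm_add_smul H m x₀ (x₀ - x) t
    have e' := maxTerm_add_smul H m x (x₀ - x) 1
    rw [show x + (1 : ℝ) • (x₀ - x) = x₀ by simp] at e'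
    rw [mem_maximizers_iff hH] at hm hm₀ hmx
    rw [hm.2, hm₀.2] at e
    rw [hm₀.2, hmx.2] at e'
    set D := ∑ i, (m i : ℝ) * (x₀ - x) i
    have hfz : f (x₀ + t • (x₀ - x)) = f x₀ + t * (f x₀ - f x) := by
      simp only [map_add, map_smul, map_sub, smul_eq_mul]
    rw [hfz, e] at hz
    have hle : f x₀ - f x - c * D ≤ 0 := by
      have : t * (f x₀ - f x - c * D) ≤ 0 := by linarith
      exact nonpos_of_mul_nonpos_right this ht
    intro y
    have := hx₀ y
    have e'' : c * maxValue H hH x₀ = c * maxValue H hH x + c * D := by rw [e']; ring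
    linarith

theorem mem_maxDome_iff (hH : (maxSupp H).Nonempty) {q : (Fin d → ℝ) × ℝ} :
    q ∈ maxDome H ↔ maxValue H hH q.1 ≤ q.2 :=
  (maxValue_le_iff hH).symm

theorem exists_eq_stratum_of_mem_normalComplex (hH : (maxSupp H).Nonempty)
    {σ : Set (Fin d → ℝ)} (hσ : σ ∈ normalComplex H) : ∃ x₀, σ = stratum H x₀ := by
  obtain ⟨F, hF, hFne, hFproper, rfl⟩ := hσ
  obtain ⟨l, rfl⟩ := hF hFne
  obtain ⟨p, hpD, hpmax⟩ := hFne
  let f : (Fin d → ℝ) →ₗ[ℝ] ℝ := l.toLinearMap ∘ₗ LinearMap.inl ℝ (Fin d → ℝ) ℝ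
  have hl : ∀ q, l q = f q.1 - -l (0, 1) * q.2 := fun q => by
    change l q = l (q.1, 0) - -l (0, 1) * q.2
    rw [neg_mul, sub_neg_eq_add, mul_comm, ← smul_eq_mul, ← map_smul, ← map_add]
    simp
  set c := -l (0, 1) with hcdef
  have hval : ∀ x, (x, maxValue H hH x) ∈ maxDome H := fun x => (mem_maxDome_iff hH).2 le_rfl
  have hc0 : 0 ≤ c := by
    have h := hpmax (p.1, p.2 + 1) ((mem_maxDome_iff hH).2
      (((mem_maxDome_iff hH).1 hpD).trans (by simp)))
    rw [hl, hl p] at h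
    dsimp only at h
    linarith
  have hc : 0 < c := by
    refine lt_of_le_of_ne hc0 fun h0 => hFproper ?_
    -- A functional without vertical component that is bounded above on the dome vanishes.
    have hle : ∀ z, f z ≤ 0 := fun z => by
      have h := hpmax _ (hval (p.1 + z))
      rw [hl, hl p, ← h0, map_add] at h
      linarith
    have hf0 : ∀ z, f z = 0 := fun z => by
      have h1 := hle z
      have h2 := hle (-z)
      rw [map_neg] at h2
      linarith
    ext q
    simp only [mem_ofPred_eq, and_iff_left_iff_imp]
    intro _ y _
    rw [hl, hl q, ← h0, hf0, hf0]
    simp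
  have heq : Prod.fst '' {x | x ∈ maxDome H ∧ ∀ y ∈ maxDome H, l y ≤ l x} =
      {x | ∀ y, f y - c * maxValue H hH y ≤ f x - c * maxValue H hH x} := by
    ext x
    constructor
    · rintro ⟨q, ⟨hq, hqmax⟩, rfl⟩ y
      have h := hqmax _ (hval y)
      rw [hl, hl q] at h
      have := mul_le_mul_of_nonneg_left ((mem_maxDome_iff hH).1 hq) hc0
      dsimp only at h
      linarith
    · intro hx
      refine ⟨(x, maxValue H hH x), ⟨hval x, fun y hy => ?_⟩, rfl⟩
      have := mul_le_mul_of_nonneg_left ((mem_maxDome_iff hH).1 hy) hc0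
      have := hx y.1
      rw [hl, hl (x, _)]
      dsimp only
      linarith
  rw [heq]
  exact exists_argmax_eq_stratum hH f hc (heq ▸ ⟨p.1, p, ⟨hpD, hpmax⟩, rfl⟩)

theorem stratum_mem_normalComplex (hH : (maxSupp H).Nonempty) (x₀ : Fin d → ℝ) :
    stratum H x₀ ∈ normalComplex H := by
  obtain ⟨m₀, hm₀⟩ := maximizers_nonempty hH x₀
  have hval : ∀ x, (x, maxValue H hH x) ∈ maxDome H := fun x => (mem_maxDome_iff hH).2 le_rfl
  have hmem : ∀ q, q ∈ {q ∈ maxDome H | ∀ m ∈ maximizers H x₀, maxTerm H m q.1 = q.2} ↔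
      q.1 ∈ stratum H x₀ ∧ q.2 = maxValue H hH q.1 := by
    rintro ⟨x, s⟩
    constructor
    · rintro ⟨hq, h⟩
      have h1 : maxValue H hH x ≤ s := (mem_maxDome_iff hH (q := (x, s))).1 hq
      have h2 : maxTerm H m₀ x = s := h m₀ hm₀
      have hs : s = maxValue H hH x :=
        le_antisymm (h2 ▸ maxTerm_le_maxValue hH hm₀.1 x) h1
      exact ⟨fun m hm => (mem_maximizers_iff hH).2 ⟨hm.1, (h m hm).trans hs⟩, hs⟩
    · rintro ⟨hx, hs⟩
      dsimp only at hs hx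
      subst hs
      exact ⟨hval x, fun m hm => ((mem_maximizers_iff hH).1 (hx hm)).2⟩
  refine ⟨{q ∈ maxDome H | ∀ m ∈ maximizers H x₀, maxTerm H m q.1 = q.2}, fun _ => ?_,
    ⟨(x₀, maxValue H hH x₀), (hmem _).2 ⟨self_mem_stratum H x₀, rfl⟩⟩, fun h => ?_, ?_⟩
  · -- The functional is the sum of `m · x - s` over the terms `m` that are maximal at `x₀`.
    obtain ⟨S, hS⟩ : ∃ S : Finset (Fin d → ℤ), ∀ m, m ∈ S ↔ m ∈ maximizers H x₀ :=
      ⟨(maximizers_finite H x₀).toFinset, fun m => (maximizers_finite H x₀).mem_toFinset⟩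
    let l : ((Fin d → ℝ) × ℝ) →ₗ[ℝ] ℝ := ∑ m ∈ S,
      (dotProductEquiv ℝ (Fin d) (latticePt m) ∘ₗ LinearMap.fst ℝ (Fin d → ℝ) ℝ -
        LinearMap.snd ℝ (Fin d → ℝ) ℝ)
    have hl : ∀ q, l q = ∑ m ∈ S, (maxTerm H m q.1 - q.2) - ∑ m ∈ S, maxCoeff H m := fun q => by
      rw [← Finset.sum_sub_distrib]
      rw [LinearMap.sum_apply]
      refine Finset.sum_congr rfl fun m _ => ?_
      simp only [LinearMap.sub_apply, LinearMap.comp_apply, LinearMap.fst_apply,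
        LinearMap.snd_apply, dotProductEquiv_apply_apply, dotProduct, latticePt, maxTerm]
      ring
    refine ⟨LinearMap.toContinuousLinearMap l, ?_⟩
    have hterm : ∀ q ∈ maxDome H, ∀ m ∈ S, maxTerm H m q.1 - q.2 ≤ 0 := fun q hq m hm =>
      sub_nonpos.2 (hq m ((hS m).1 hm).1)
    ext q
    refine and_congr_right fun hq => ⟨fun h y hy => ?_, fun h m hm => ?_⟩
    · rw [LinearMap.coe_toContinuousLinearMap', hl, hl]
      rw [Finset.sum_eq_zero (s := S) (f := fun m => maxTerm H m q.1 - q.2) fun m hm =>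
        sub_eq_zero.2 (h m ((hS m).1 hm))]
      have := Finset.sum_nonpos (hterm y hy)
      linarith
    · have h0 := h _ (hval x₀)
      rw [LinearMap.coe_toContinuousLinearMap', hl, hl] at h0
      rw [Finset.sum_eq_zero (s := S) (f := fun m => maxTerm H m x₀ - maxValue H hH x₀) fun m hm =>
        sub_eq_zero.2 ((mem_maximizers_iff hH).1 ((hS m).1 hm)).2] at h0
      have h1 : ∑ m ∈ S, (maxTerm H m q.1 - q.2) = 0 :=
        (Finset.sum_nonpos (hterm q hq)).antisymm (by linarith)
      exact sub_eq_zero.1 ((Finset.sum_eq_zero_iff_of_nonpos (hterm q hq)).1 h1 m ((hS m).2 hm))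
  · have h1 : (x₀, maxValue H hH x₀ + 1) ∈ maxDome H := (mem_maxDome_iff hH).2 (by simp)
    rw [← h, hmem] at h1
    simp at h1
  · ext x
    constructor
    · exact fun hx => ⟨(x, maxValue H hH x), (hmem _).2 ⟨hx, rfl⟩, rfl⟩
    · rintro ⟨q, hq, rfl⟩
      exact ((hmem q).1 hq).1

theorem normalComplex_eq_range (hH : (maxSupp H).Nonempty) :
    normalComplex H = range (stratum H) := by
  ext σ
  constructor
  · intro hσ
    obtain ⟨x, rfl⟩ := exists_eq_stratum_of_mem_normalComplex hH hσ
    exact ⟨x, rfl⟩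
  · rintro ⟨x, rfl⟩
    exact stratum_mem_normalComplex hH x

end Normal

/-! ### Duality -/

section Duality

variable {H : MaxPoly d}

/-- The dual cell of a point: the convex hull of the exponents of the terms maximal there. -/
def dualCell (H : MaxPoly d) (x : Fin d → ℝ) : Set (Fin d → ℝ) :=
  convexHull ℝ (latticePt '' maximizers H x)

theorem stratum_subset_stratum_iff {x y : Fin d → ℝ} :
    stratum H x ⊆ stratum H y ↔ maximizers H y ⊆ maximizers H x :=
  ⟨fun h => h (self_mem_stratum H x), fun h _ hz => h.trans hz⟩

theorem setOf_forall_mem_stratum (H : MaxPoly d) (x : Fin d → ℝ) :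
    {m | ∀ y ∈ stratum H x, m ∈ maximizers H y} = maximizers H x :=
  Subset.antisymm (fun _ hm => hm x (self_mem_stratum H x)) fun _ hm _ hy => hy hm

/-- Dual cells are compared through the maximizers that span them. On the cell of `x`, the functional
`q ↦ q · (y - x)` is at most `H y - H x`. So a term that is maximal at `y` and has its exponent in
this cell loses at most `H y - H x` on the way to `x`, and is maximal there too. -/
theorem dualCell_subset_dualCell_iff (hH : (maxSupp H).Nonempty) {x y : Fin d → ℝ} :
    dualCell H y ⊆ dualCell H x ↔ maximizers H y ⊆ maximizers H x := by
  refine ⟨fun h m hm => ?_, fun h => convexHull_mono (image_mono h)⟩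
  have hmx : latticePt m ∈ dualCell H x := h (subset_convexHull ℝ _ ⟨m, hm, rfl⟩)
  have hdot : ∀ m : Fin d → ℤ, dotProductEquiv ℝ (Fin d) (y - x) (latticePt m) =
      maxTerm H m y - maxTerm H m x := fun m => by
    simp only [dotProductEquiv_apply_apply, dotProduct, latticePt, maxTerm, Pi.sub_apply, sub_mul,
      Finset.sum_sub_distrib, mul_comm]
    ring
  have hle : dotProductEquiv ℝ (Fin d) (y - x) (latticePt m) ≤
      maxValue H hH y - maxValue H hH x := by
    refine convexHull_min (t := {q | dotProductEquiv ℝ (Fin d) (y - x) q ≤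
      maxValue H hH y - maxValue H hH x}) ?_
      (convex_halfSpace_le (dotProductEquiv ℝ (Fin d) (y - x)).isLinear _) hmx
    rintro _ ⟨a, ha, rfl⟩
    rw [mem_ofPred_eq, hdot, ((mem_maximizers_iff hH).1 ha).2]
    exact sub_le_sub_right (maxTerm_le_maxValue hH ha.1 y) _
  rw [hdot, ((mem_maximizers_iff hH).1 hm).2] at hle
  exact (mem_maximizers_iff hH).2
    ⟨hm.1, (maxTerm_le_maxValue hH hm.1 x).antisymm (by linarith)⟩

theorem vectorSpan_dualCell (H : MaxPoly d) (x : Fin d → ℝ) :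
    vectorSpan ℝ (dualCell H x) = vectorSpan ℝ (latticePt '' maximizers H x) := by
  rw [← direction_affineSpan, ← direction_affineSpan, dualCell, affineSpan_convexHull]

/-- The directions of a stratum are those orthogonal to its dual cell. -/
theorem vectorSpan_stratum (hH : (maxSupp H).Nonempty) (x : Fin d → ℝ) :
    vectorSpan ℝ (stratum H x) = ((vectorSpan ℝ (dualCell H x)).map
      (dotProductEquiv ℝ (Fin d)).toLinearMap).dualCoannihilator := by
  have hdiff : ∀ (m m' : Fin d → ℤ) (y z : Fin d → ℝ),
      dotProductEquiv ℝ (Fin d) (latticePt m - latticePt m') (y - z) =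
        (maxTerm H m y - maxTerm H m' y) - (maxTerm H m z - maxTerm H m' z) := fun m m' y z => by
    simp only [dotProductEquiv_apply_apply, dotProduct, latticePt, maxTerm, Pi.sub_apply, sub_mul,
      mul_sub, Finset.sum_sub_distrib]
    ring
  rw [vectorSpan_dualCell]
  apply le_antisymm
  · rw [vectorSpan, Submodule.span_le]
    rintro _ ⟨y, hy, z, hz, rfl⟩
    rw [SetLike.mem_coe, Submodule.mem_dualCoannihilator]
    rintro _ ⟨w, hw, rfl⟩
    induction hw using Submodule.span_induction with
    | mem w hw =>
      obtain ⟨_, ⟨m, hm, rfl⟩, _, ⟨m', hm', rfl⟩, rfl⟩ := hw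
      have h1 := ((mem_maximizers_iff hH).1 (hy hm)).2
      have h2 := ((mem_maximizers_iff hH).1 (hy hm')).2
      have h3 := ((mem_maximizers_iff hH).1 (hz hm)).2
      have h4 := ((mem_maximizers_iff hH).1 (hz hm')).2
      simp only [vsub_eq_sub, LinearEquiv.coe_coe]
      rw [hdiff, h1, h2, h3, h4]
      ring
    | zero => simp
    | add v w _ _ hv hw => rw [map_add, LinearMap.add_apply, hv, hw, add_zero]
    | smul c v _ hv => rw [map_smul, LinearMap.smul_apply, hv, smul_zero]
  · intro z hz
    rw [Submodule.mem_dualCoannihilator] at hz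
    obtain ⟨t, ht, hts⟩ := exists_pos_maximizers_add_smul_subset hH x z
    obtain ⟨m₁, hm₁⟩ := maximizers_nonempty hH (x + t • z)
    have hmem : x + t • z ∈ stratum H x := by
      intro m hm
      have hm₁x := hts hm₁
      have h0 := hz _ ⟨_, vsub_mem_vectorSpan ℝ ⟨m, hm, rfl⟩ ⟨m₁, hm₁x, rfl⟩, rfl⟩
      have h1 := hdiff m m₁ (x + t • z) x
      rw [add_sub_cancel_left, map_smul] at h1
      simp only [vsub_eq_sub, LinearEquiv.coe_coe] at h0
      rw [h0, smul_zero] at h1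
      rw [mem_maximizers_iff hH] at hm hm₁ hm₁x ⊢
      exact ⟨hm.1, by linarith [hm.2, hm₁.2, hm₁x.2]⟩
    have h2 := vsub_mem_vectorSpan ℝ hmem (self_mem_stratum H x)
    rw [vsub_eq_sub, add_sub_cancel_left] at h2
    simpa [smul_smul, ht.ne'] using (vectorSpan ℝ (stratum H x)).smul_mem t⁻¹ h2

theorem affDim_stratum_add_affDim_dualCell (hH : (maxSupp H).Nonempty) (x : Fin d → ℝ) :
    affDim (stratum H x) + affDim (dualCell H x) = d := by
  have h := Subspace.finrank_add_finrank_dualCoannihilator_eq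
    ((vectorSpan ℝ (dualCell H x)).map (dotProductEquiv ℝ (Fin d)).toLinearMap)
  rw [← vectorSpan_stratum hH, LinearEquiv.finrank_map_eq, Module.finrank_fin_fun] at h
  rw [affDim, affDim, add_comm]
  exact h

theorem latticePt_injective : Function.Injective (latticePt : (Fin d → ℤ) → Fin d → ℝ) :=
  fun _ _ h => funext fun i => Int.cast_injective (congrFun h i)

theorem affDim_dualCell_pos_iff (H : MaxPoly d) (x : Fin d → ℝ) :
    0 < affDim (dualCell H x) ↔ (maximizers H x).Nontrivial := by
  rw [affDim, vectorSpan_dualCell, Nat.pos_iff_ne_zero, Ne, Submodule.finrank_eq_zero,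
    vectorSpan_eq_bot_iff_subsingleton,
    latticePt_injective.subsingleton_image_iff, not_subsingleton_iff]

/-- The hypersurface consists of the strata that are not full-dimensional. -/
theorem maxHypersurface_eq_sUnion (hH : (maxSupp H).Nonempty) :
    maxHypersurface H = ⋃₀ {σ | σ ∈ normalComplex H ∧ affDim σ < d} := by
  have hdim : ∀ x, affDim (stratum H x) < d ↔ (maximizers H x).Nontrivial := fun x => by
    have := affDim_stratum_add_affDim_dualCell hH x
    rw [← affDim_dualCell_pos_iff]
    omega
  ext x
  constructor
  · exact fun hx => ⟨stratum H x, ⟨stratum_mem_normalComplex hH x, (hdim x).2 hx⟩,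
      self_mem_stratum H x⟩
  · rintro ⟨σ, ⟨hσ, hσd⟩, hx⟩
    obtain ⟨y, rfl⟩ := exists_eq_stratum_of_mem_normalComplex hH hσ
    exact ((hdim y).1 hσd).mono hx

/-- The set of all dual cells of a max-tropical polynomial is dual to its hypersurface. -/
theorem isDualToHypersurface_range_dualCell (hH : (maxSupp H).Nonempty) :
    IsDualToHypersurface (range (dualCell H)) H := by
  refine ⟨maxHypersurface_eq_sUnion hH, ?_⟩
  have hcell : ∀ x, convexHull ℝ (latticePt '' {m | ∀ y ∈ stratum H x, m ∈ maximizers H y}) =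
      dualCell H x := fun x => by rw [setOf_forall_mem_stratum, dualCell]
  have hmem : ∀ σ : normalComplex H, convexHull ℝ (latticePt ''
      {m | ∀ y ∈ (σ : Set (Fin d → ℝ)), m ∈ maximizers H y}) ∈ range (dualCell H) := by
    rintro ⟨σ, hσ⟩
    obtain ⟨x, rfl⟩ := exists_eq_stratum_of_mem_normalComplex hH hσ
    exact ⟨x, (hcell x).symm⟩
  let f : normalComplex H → (range (dualCell H))ᵒᵈ := fun σ => OrderDual.toDual ⟨_, hmem σ⟩
  have hf : ∀ σ τ, f σ ≤ f τ ↔ σ ≤ τ := by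
    rintro ⟨σ, hσ⟩ ⟨τ, hτ⟩
    obtain ⟨x, rfl⟩ := exists_eq_stratum_of_mem_normalComplex hH hσ
    obtain ⟨y, rfl⟩ := exists_eq_stratum_of_mem_normalComplex hH hτ
    rw [OrderDual.toDual_le_toDual, Subtype.mk_le_mk, Subtype.mk_le_mk, hcell, hcell]
    exact (dualCell_subset_dualCell_iff hH).trans stratum_subset_stratum_iff.symm
  have hsurj : Function.Surjective f := by
    rintro ⟨_, x, rfl⟩
    exact ⟨⟨stratum H x, stratum_mem_normalComplex hH x⟩,
      congrArg OrderDual.toDual (Subtype.ext (hcell x))⟩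
  refine ⟨RelIso.ofSurjective (OrderEmbedding.ofMapLEIff f hf) hsurj, ?_⟩
  rintro ⟨σ, hσ⟩
  refine ⟨rfl, ?_⟩
  obtain ⟨x, rfl⟩ := exists_eq_stratum_of_mem_normalComplex hH hσ
  have h := affDim_stratum_add_affDim_dualCell hH x
  rw [← hcell] at h
  exact h

end Duality

end TropCayley

end

theorem mainTheorem3 (d n : ℕ) (hn : 0 < n)
    (V : Matrix (Fin d) (Fin n) (WithTop ℝ)) (hV : ∀ k, ∃ i, V i k ≠ ⊤)
    (u : AffineBasis (Fin n) ℝ (Fin (n - 1) → ℝ)) :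
    TropCayley.polySubdivision (TropCayley.columnProduct V) =
        TropCayley.mixedSubdivision u (fun k => TropCayley.minLinearForm fun i => V i k) ∧
      (∀ A : Fin n → Finset (Fin d → ℤ),
        TropCayley.IsMixedLabel u (fun k => TropCayley.minLinearForm fun i => V i k) A →
        ∀ k, convexHull ℝ (TropCayley.latticePt '' (A k : Set (Fin d → ℤ))) ∈
          TropCayley.polySubdivision (TropCayley.minLinearForm fun i => V i k)) ∧
      TropCayley.IsDualToHypersurface
        (TropCayley.polySubdivision (TropCayley.columnProduct V))
        (TropCayley.negColumnProduct V) := by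
  have hF : ∀ k, (TropCayley.minSupp (TropCayley.minLinearForm fun i => V i k)).Nonempty :=
    fun k => TropCayley.minSupp_minLinearForm_nonempty (hV k)
  have hprod : (TropCayley.minSupp (TropCayley.columnProduct V)).Nonempty :=
    TropCayley.minSupp_prod_nonempty _ hF
  refine ⟨TropCayley.polySubdivision_prod_eq_mixedSubdivision hn u hF, fun A hA k => ?_, ?_⟩
  · obtain ⟨-, x, hx⟩ := (TropCayley.isMixedLabel_iff hn u hF A).1 hA
    rw [TropCayley.polySubdivision_eq_range (hF k)]
    exact ⟨x, (hx k).symm⟩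
  · have hH : (TropCayley.maxSupp (TropCayley.negColumnProduct V)).Nonempty := by
      rwa [← TropCayley.map_columnProduct, TropCayley.maxSupp_map]
    have hcells : TropCayley.polySubdivision (TropCayley.columnProduct V) =
        range (TropCayley.dualCell (TropCayley.negColumnProduct V)) := by
      rw [TropCayley.polySubdivision_eq_range hprod]
      congr 1
      funext x
      rw [TropCayley.dualCell, ← TropCayley.map_columnProduct, TropCayley.maximizers_map]
    rw [hcells]
    exact TropCayley.isDualToHypersurface_range_dualCell hH
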